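/- Let $H$ be a separable infinite-dimensional complex Hilbert space, let $B(H)$ be the bounded linear operators on $H$, and let $K(H)$ be the compact ones. For a positive $a\in K(H)$ let $\lambda_1(a)\ge\lambda_2(a)\ge\cdots$ be its non-zero eigenvalues in decreasing order, counted with multiplicity, followed by zeros if $a$ has finite rank. Let $\alpha:\{0,1,2,\dots\}\to[0,\infty)$ be monotone increasing with $\alpha(0)=0$, and let $$\varphi_\alpha(a)=\sum_{i=1}^\infty\bigl(\lambda_i(a)-\lambda_{i+1}(a)\bigr)\,\alpha(i)\in[0,\infty]$$ be the non-linear trace of Choquet type associated with $\alpha$. Let $p\ge 1$ be a real number, and for $a\in K(H)$ put $|||a|||_{\alpha,p}=\varphi_\alpha(|a|^p)^{1/p}\in[0,\infty]$, where $|a|=(a^*a)^{1/2}$. **Theorem.** Suppose that $\alpha(1)>0$ and that $\alpha$ is concave, that is, $\frac{\alpha(i+1)+\alpha(i-1)}{2}\le\alpha(i)$ for all $i\ge1$. Then the weighted Schatten–von Neumann $p$-class $$\mathcal C^\alpha_p(H)=\{a\in K(H): |||a|||_{\alpha,p}<\infty\}$$ is a linear subspace of $B(H)$ and is a Banach space with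 respect to the norm $|||\cdot|||_{\alpha,p}$. Moreover, $\mathcal C^\alpha_p(H)$ is a $*$-ideal of $B(H)$, that is, a two-sided ideal closed under $a\mapsto a^*$. -/

import Mathlib

open scoped ENNReal NNReal

noncomputable section

namespace Choquet

variable {H : Type*} [NormedAddCommGroup H] [InnerProductSpace ℂ H]

/-- The span of all eigenvectors of `a` belonging to real eigenvalues `μ > t`. Since eigenspaces are
independent, its dimension is the number of eigenvalues `> t`, counted with multiplicity. -/
def upperEigenspace (a : H →L[ℂ] H) (t : ℝ) : Submodule ℂ H :=
  ⨆ (μ : ℝ) (_ : t < μ), Module.End.eigenspace (a : H →ₗ[ℂ] H) (μ : ℂ)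

/-- The eigenvalue sequence of a positive compact operator `a`: its positive eigenvalues in
decreasing order, counted with multiplicity, followed by zeros if `a` has finite rank. The index
starts at `0`, so `eigenvalueSeq a n` is the `(n + 1)`-st largest eigenvalue: the least level such
that at most `n` eigenvalues, counted with multiplicity, lie above it. -/
def eigenvalueSeq (a : H →L[ℂ] H) (n : ℕ) : ℝ :=
  sInf {t : ℝ | 0 < t ∧ Module.rank ℂ (upperEigenspace a t) ≤ n}

/-- The non-linear trace of Choquet type associated with `α`, of a positive compact operator `a`:
`∑ i ≥ 1, (λ_i(a) - λ_{i+1}(a)) α(i)`, with values in `[0, ∞]`. -/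
def choquetTrace (α : ℕ → ℝ≥0) (a : H →L[ℂ] H) : ℝ≥0∞ :=
  ∑' i : ℕ, ENNReal.ofReal (eigenvalueSeq a i - eigenvalueSeq a (i + 1)) * (α (i + 1) : ℝ≥0∞)

variable [CompleteSpace H]

/-- `φ_α(|a|^p)^{1/p}`, with values in `[0, ∞]`; here `|a| = (a* a)^{1/2}` and `|a|^p` is given by
the continuous functional calculus. -/
def schattenNorm (α : ℕ → ℝ≥0) (p : ℝ) (a : H →L[ℂ] H) : ℝ≥0∞ :=
  choquetTrace α (CFC.abs a ^ p) ^ (1 / p)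

variable (H) in
/-- The weighted Schatten-von Neumann `p`-class: the compact operators `a` on `H` with
`φ_α(|a|^p)^{1/p} < ∞`. -/
def schattenClass (α : ℕ → ℝ≥0) (p : ℝ) : Set (H →L[ℂ] H) :=
  {a | IsCompactOperator a ∧ schattenNorm α p a < ∞}

/-- The complex vector space `E` is a Banach space with respect to `N`: the function `N` is a norm
on `E`, and `E` is complete in this norm. -/
def IsBanachWith {E : Type*} [AddCommGroup E] [Module ℂ E] (N : E → ℝ) : Prop :=
  letI : Norm E := ⟨N⟩
  ∃ core : NormedSpace.Core ℂ E,
    letI : NormedAddCommGroup E := NormedAddCommGroup.ofCore core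
    CompleteSpace E

end Choquet

end

/-!
The singular values of a compact operator `a`, i.e. the eigenvalues of `|a|`, are its approximation
numbers `s_n(a) = inf {‖a - f‖ : rank f ≤ n}`: this is the Courant–Fischer principle, applied to the
quadratic form of `a* a` on its spectral subspaces. Summation by parts therefore turns
`φ_α(|a|^p)` into `∑ j, (α(j+1) - α(j)) s_j(a)^p`, the `p`-th power of a weighted `ℓ^p` norm of
`(s_j(a))`, with decreasing weights because `α` is concave.

Approximation numbers obey `s_n(b a c) ≤ ‖b‖ s_n(a) ‖c‖` and `s_n(a*) = s_n(a)`, which gives the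
`*`-ideal property. The triangle inequality follows from Ky Fan's inequality
`∑_{j<k} s_j(a + b) ≤ ∑_{j<k} s_j(a) + ∑_{j<k} s_j(b)`, since a weighted `ℓ^p` norm with decreasing
weights respects such comparisons of partial sums of decreasing sequences. Finally, each `s_n` is
continuous in operator norm, so the norm of the class is lower semicontinuous; as it also dominates
a multiple `α(1)^{1/p}` of the operator norm, completeness is inherited from `B(H)`.
-/

noncomputable section

namespace Choquet

open Filter Topology

open scoped InnerProductSpace

/-! ### Approximation numbers -/

section ApproximationNumbers

theorem exists_mem_ne_zero_apply_eq_zero {K V W : Type*} [DivisionRing K] [AddCommGroup V]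
    [Module K V] [AddCommGroup W] [Module K W] {f : V →ₗ[K] W} {n : ℕ} (hf : f.rank ≤ n)
    {S : Submodule K V} (hS : n < Module.rank K S) : ∃ x ∈ S, x ≠ 0 ∧ f x = 0 := by
  by_contra! h
  have hinj : Function.Injective (f.rangeRestrict.domRestrict S) := by
    rw [← LinearMap.ker_eq_bot, LinearMap.ker_eq_bot']
    intro x hx
    by_contra hx0
    exact h x x.2 (Subtype.coe_ne_coe.mpr hx0) (congrArg Subtype.val hx)
  have hle : Cardinal.lift (Module.rank K S) ≤ n :=
    (LinearMap.lift_rank_le_of_injective _ hinj).trans (Cardinal.lift_le_nat_iff.mpr hf)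
  exact hS.not_ge (Cardinal.lift_le_nat_iff.mp hle)

variable {𝕜 E F G : Type*} [NontriviallyNormedField 𝕜] [NormedAddCommGroup E] [NormedSpace 𝕜 E]
  [NormedAddCommGroup F] [NormedSpace 𝕜 F] [NormedAddCommGroup G] [NormedSpace 𝕜 G]

instance (n : ℕ) : Nonempty {f : E →L[𝕜] F // LinearMap.rank (f : E →ₗ[𝕜] F) ≤ n} :=
  ⟨0, by simp⟩

/-- The `n`-th approximation number of a bounded operator: its distance to the operators of rank
at most `n`. The index starts at `0`, so that `approxNumber a 0 = ‖a‖₊`. -/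
def approxNumber (a : E →L[𝕜] F) (n : ℕ) : ℝ≥0 :=
  Metric.infNndist a {f : E →L[𝕜] F | LinearMap.rank (f : E →ₗ[𝕜] F) ≤ n}

theorem approxNumber_le {a f : E →L[𝕜] F} {n : ℕ} (hf : LinearMap.rank (f : E →ₗ[𝕜] F) ≤ n) :
    approxNumber a n ≤ ‖a - f‖₊ := by
  simpa [← NNReal.coe_le_coe, approxNumber, dist_eq_norm] using
    Metric.infDist_le_dist_of_mem (x := a) hf

theorem approxNumber_eq_iInf (a : E →L[𝕜] F) (n : ℕ) :
    approxNumber a n =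
      ⨅ f : {f : E →L[𝕜] F // LinearMap.rank (f : E →ₗ[𝕜] F) ≤ n}, ‖a - f‖₊ := by
  rw [← NNReal.coe_inj, approxNumber, Metric.coe_infNndist, Metric.infDist_eq_iInf, NNReal.coe_iInf]
  simp only [dist_eq_norm]
  rfl

theorem approxNumber_lt_iff {a : E →L[𝕜] F} {n : ℕ} {r : ℝ≥0} :
    approxNumber a n < r ↔ ∃ f : E →L[𝕜] F, LinearMap.rank (f : E →ₗ[𝕜] F) ≤ n ∧ ‖a - f‖₊ < r := by
  simp [approxNumber_eq_iInf, ciInf_lt_iff (OrderBot.bddBelow _)]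

theorem le_approxNumber_iff {a : E →L[𝕜] F} {n : ℕ} {r : ℝ≥0} :
    r ≤ approxNumber a n ↔
      ∀ f : E →L[𝕜] F, LinearMap.rank (f : E →ₗ[𝕜] F) ≤ n → r ≤ ‖a - f‖₊ := by
  simp [← not_lt, approxNumber_lt_iff]

theorem continuous_approxNumber (n : ℕ) : Continuous fun a : E →L[𝕜] F => approxNumber a n :=
  Metric.continuous_infNndist_pt _

theorem approxNumber_antitone (a : E →L[𝕜] F) : Antitone (approxNumber a) := fun _ _ hmn =>
  le_approxNumber_iff.mpr fun _ hf => approxNumber_le (hf.trans (mod_cast hmn))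

theorem approxNumber_zero (a : E →L[𝕜] F) : approxNumber a 0 = ‖a‖₊ := by
  refine le_antisymm ?_ (le_approxNumber_iff.mpr fun f hf => ?_)
  · simpa using approxNumber_le (a := a) (f := 0) (n := 0) (by simp)
  · have hrange : LinearMap.range (f : E →ₗ[𝕜] F) = ⊥ := by
      simpa [LinearMap.rank, Submodule.rank_eq_zero] using hf
    have hf0 : f = 0 := ContinuousLinearMap.coe_inj.mp (LinearMap.range_eq_bot.mp hrange)
    simp [hf0]

theorem approxNumber_eq_zero_of_rank_le {a : E →L[𝕜] F} {n : ℕ}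
    (ha : LinearMap.rank (a : E →ₗ[𝕜] F) ≤ n) : approxNumber a n = 0 := by
  simpa using approxNumber_le (a := a) ha

theorem approxNumber_comp_le_right (a : F →L[𝕜] G) (b : E →L[𝕜] F) (n : ℕ) :
    approxNumber (a ∘L b) n ≤ approxNumber a n * ‖b‖₊ := by
  rw [approxNumber_eq_iInf a, NNReal.iInf_mul]
  refine le_ciInf fun f => ?_
  calc approxNumber (a ∘L b) n ≤ ‖a ∘L b - f.1 ∘L b‖₊ :=
        approxNumber_le ((LinearMap.rank_comp_le_left (b : E →ₗ[𝕜] F) (f.1 : F →ₗ[𝕜] G)).trans f.2)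
    _ = ‖(a - f.1) ∘L b‖₊ := by rw [ContinuousLinearMap.sub_comp]
    _ ≤ ‖a - f.1‖₊ * ‖b‖₊ := ContinuousLinearMap.opNNNorm_comp_le _ _

theorem approxNumber_comp_le_left (a : E →L[𝕜] F) (b : F →L[𝕜] G) (n : ℕ) :
    approxNumber (b ∘L a) n ≤ ‖b‖₊ * approxNumber a n := by
  rw [approxNumber_eq_iInf a, NNReal.mul_iInf]
  refine le_ciInf fun f => ?_
  have hrank : LinearMap.rank ((b ∘L f.1 : E →L[𝕜] G) : E →ₗ[𝕜] G) ≤ n :=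
    Cardinal.lift_le_nat_iff.mp
      ((LinearMap.lift_rank_comp_le_right (f.1 : E →ₗ[𝕜] F) (b : F →ₗ[𝕜] G)).trans
        (Cardinal.lift_le_nat_iff.mpr f.2))
  calc approxNumber (b ∘L a) n ≤ ‖b ∘L a - b ∘L f.1‖₊ := approxNumber_le hrank
    _ = ‖b ∘L (a - f.1)‖₊ := by rw [ContinuousLinearMap.comp_sub]
    _ ≤ ‖b‖₊ * ‖a - f.1‖₊ := ContinuousLinearMap.opNNNorm_comp_le _ _

theorem approxNumber_smul_le (c : 𝕜) (a : E →L[𝕜] F) (n : ℕ) :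
    approxNumber (c • a) n ≤ ‖c‖₊ * approxNumber a n := by
  have hc : ‖c • ContinuousLinearMap.id 𝕜 F‖₊ ≤ ‖c‖₊ := by
    rw [nnnorm_smul]
    exact mul_le_of_le_one_right' ContinuousLinearMap.norm_id_le
  calc approxNumber (c • a) n = approxNumber ((c • ContinuousLinearMap.id 𝕜 F) ∘L a) n := by simp
    _ ≤ ‖c • ContinuousLinearMap.id 𝕜 F‖₊ * approxNumber a n := approxNumber_comp_le_left _ _ n
    _ ≤ ‖c‖₊ * approxNumber a n := by gcongr

theorem approxNumber_smul (c : 𝕜) (a : E →L[𝕜] F) (n : ℕ) :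
    approxNumber (c • a) n = ‖c‖₊ * approxNumber a n := by
  refine le_antisymm (approxNumber_smul_le c a n) ?_
  rcases eq_or_ne c 0 with rfl | hc
  · simp
  · calc ‖c‖₊ * approxNumber a n = ‖c‖₊ * approxNumber (c⁻¹ • c • a) n := by
          rw [inv_smul_smul₀ hc]
      _ ≤ ‖c‖₊ * (‖c⁻¹‖₊ * approxNumber (c • a) n) := by
          gcongr
          exact approxNumber_smul_le _ _ n
      _ = approxNumber (c • a) n := by
          rw [nnnorm_inv, mul_inv_cancel_left₀ (nnnorm_ne_zero_iff.mpr hc)]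

theorem le_approxNumber_of_forall_mem {a : E →L[𝕜] F} {n : ℕ} {S : Submodule 𝕜 E}
    (hS : n < Module.rank 𝕜 S) {r : ℝ≥0} (h : ∀ x ∈ S, r * ‖x‖ ≤ ‖a x‖) :
    r ≤ approxNumber a n := by
  refine le_approxNumber_iff.mpr fun f hf => ?_
  obtain ⟨x, hxS, hx0, hfx⟩ := exists_mem_ne_zero_apply_eq_zero hf hS
  refine le_of_mul_le_mul_right (a := ‖x‖) ?_ (norm_pos_iff.mpr hx0)
  calc r * ‖x‖ ≤ ‖a x‖ := h x hxS
    _ = ‖(a - f) x‖ := by simpa using congrArg (‖a x - ·‖) hfx.symm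
    _ ≤ ‖a - f‖ * ‖x‖ := (a - f).le_opNorm x

theorem mem_closure_rank_lt_of_tendsto_approxNumber {a : E →L[𝕜] F}
    (ha : Tendsto (approxNumber a) atTop (𝓝 0)) :
    a ∈ closure {f : E →L[𝕜] F | LinearMap.rank (f : E →ₗ[𝕜] F) < Cardinal.aleph0} := by
  rw [Metric.mem_closure_iff]
  intro ε hε
  obtain ⟨n, hn⟩ := (ha.eventually_lt_const (Real.toNNReal_pos.mpr hε)).exists
  obtain ⟨f, hf, hfa⟩ := approxNumber_lt_iff.mp hn
  exact ⟨f, hf.trans_lt Cardinal.natCast_lt_aleph0, by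
    rwa [dist_eq_norm, ← coe_nnnorm, ← Real.lt_toNNReal_iff_coe_lt]⟩

end ApproximationNumbers

section HilbertSpace

variable {𝕜 E F : Type*} [RCLike 𝕜] [NormedAddCommGroup E] [InnerProductSpace 𝕜 E]
  [NormedAddCommGroup F]

theorem approxNumber_le_of_forall_mem_orthogonal [NormedSpace 𝕜 F] {a : E →L[𝕜] F} {n : ℕ}
    {S : Submodule 𝕜 E} (hS : Module.rank 𝕜 S ≤ n) {r : ℝ≥0}
    (h : ∀ x ∈ Sᗮ, ‖a x‖ ≤ r * ‖x‖) : approxNumber a n ≤ r := by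
  have : FiniteDimensional 𝕜 S :=
    Module.rank_lt_aleph0_iff.mp (hS.trans_lt Cardinal.natCast_lt_aleph0)
  have hrank : LinearMap.rank ((a ∘L S.starProjection : E →L[𝕜] F) : E →ₗ[𝕜] F) ≤ n := by
    have hrange : LinearMap.rank (S.starProjection : E →ₗ[𝕜] E) ≤ n := by
      rwa [LinearMap.rank, Submodule.range_starProjection]
    exact Cardinal.lift_le_nat_iff.mp
      ((LinearMap.lift_rank_comp_le_right (S.starProjection : E →ₗ[𝕜] E) (a : E →ₗ[𝕜] F)).trans
        (Cardinal.lift_le_nat_iff.mpr hrange))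
  refine (approxNumber_le hrank).trans (ContinuousLinearMap.opNorm_le_bound _ r.2 fun x => ?_)
  have hx : x - S.starProjection x ∈ Sᗮ := S.sub_starProjection_mem_orthogonal x
  calc ‖(a - a ∘L S.starProjection) x‖ = ‖a (x - S.starProjection x)‖ := by simp
    _ ≤ r * ‖x - S.starProjection x‖ := h _ hx
    _ ≤ r * ‖x‖ := by
      gcongr
      simpa using Sᗮ.norm_starProjection_apply_le x

theorem approxNumber_comp_subtypeL [NormedSpace 𝕜 F] {f : E →L[𝕜] F} {U : Submodule 𝕜 E}
    [U.HasOrthogonalProjection] (hU : ∀ x ∈ Uᗮ, f x = 0) (n : ℕ) :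
    approxNumber (f ∘L U.subtypeL) n = approxNumber f n := by
  refine le_antisymm ?_ ?_
  · refine (approxNumber_comp_le_right f U.subtypeL n).trans (mul_le_of_le_one_right' ?_)
    exact U.norm_subtypeL_le
  · have hf : f = (f ∘L U.subtypeL) ∘L U.orthogonalProjectionOnto := by
      ext x
      have := hU _ (U.sub_starProjection_mem_orthogonal x)
      rwa [map_sub, sub_eq_zero] at this
    conv_lhs => rw [hf]
    refine (approxNumber_comp_le_right _ _ n).trans (mul_le_of_le_one_right' ?_)
    exact U.orthogonalProjectionOnto_norm_le

variable [InnerProductSpace 𝕜 F] [CompleteSpace E] [CompleteSpace F]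

theorem rank_adjoint_le {f : E →L[𝕜] F} {n : ℕ} (hf : LinearMap.rank (f : E →ₗ[𝕜] F) ≤ n) :
    LinearMap.rank (f.adjoint : F →ₗ[𝕜] E) ≤ n := by
  let R := LinearMap.range (f : E →ₗ[𝕜] F)
  have : FiniteDimensional 𝕜 R :=
    Module.rank_lt_aleph0_iff.mp (hf.trans_lt Cardinal.natCast_lt_aleph0)
  have hrange : LinearMap.range (f.adjoint : F →ₗ[𝕜] E) ≤ R.map (f.adjoint : F →ₗ[𝕜] E) := by
    rintro _ ⟨y, rfl⟩
    obtain ⟨u, hu, v, hv, rfl⟩ := R.exists_add_mem_mem_orthogonal y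
    have hv0 : f.adjoint v = 0 := by
      rwa [f.orthogonal_range] at hv
    exact ⟨u, hu, by simp [hv0]⟩
  have hrank := (Cardinal.lift_le.mpr (Submodule.rank_mono hrange)).trans
    (lift_rank_map_le (f.adjoint : F →ₗ[𝕜] E) R)
  exact Cardinal.lift_le_nat_iff.mp (hrank.trans (Cardinal.lift_le_nat_iff.mpr hf))

theorem approxNumber_adjoint_le (a : E →L[𝕜] F) (n : ℕ) :
    approxNumber a.adjoint n ≤ approxNumber a n :=
  le_approxNumber_iff.mpr fun f hf => by
    simpa [← map_sub] using approxNumber_le (a := a.adjoint) (rank_adjoint_le hf)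

theorem approxNumber_adjoint (a : E →L[𝕜] F) (n : ℕ) :
    approxNumber a.adjoint n = approxNumber a n :=
  le_antisymm (approxNumber_adjoint_le a n) (by simpa using approxNumber_adjoint_le a.adjoint n)

end HilbertSpace

/-! ### Ky Fan's inequality -/

section SingularValues

theorem rank_span_image_finset {K V ι : Type*} [Ring K] [StrongRankCondition K] [AddCommGroup V]
    [Module K V] {v : ι → V} (hv : LinearIndependent K v) (s : Finset ι) :
    Module.rank K (Submodule.span K (v '' s)) = s.card := by
  classical
  have := nontrivial_of_invariantBasisNumber K
  rw [rank_span_set (hv.linearIndepOn s).id_image, ← Finset.coe_image, Finset.coe_sort_coe,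
    Cardinal.mk_coe_finset, Finset.card_image_of_injective _ hv.injective]

variable {𝕜 E F : Type*} [RCLike 𝕜] [NormedAddCommGroup E] [InnerProductSpace 𝕜 E]
  [NormedAddCommGroup F] [InnerProductSpace 𝕜 F]

theorem norm_sq_sum_of_pairwise_inner_eq_zero {ι : Type*} [Fintype ι] {v : ι → E}
    (hv : Pairwise fun i j => ⟪v i, v j⟫_𝕜 = 0) : ‖∑ i, v i‖ ^ 2 = ∑ i, ‖v i‖ ^ 2 := by
  rw [← inner_self_eq_norm_sq (𝕜 := 𝕜), sum_inner, map_sum]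
  refine Finset.sum_congr rfl fun i _ => ?_
  rw [inner_sum, Finset.sum_eq_single i (fun j _ hji => hv hji.symm) (by simp),
    inner_self_eq_norm_sq]

theorem inner_eq_zero_of_mem_span_image {ι : Type*} {v : ι → E} (hv : Orthonormal 𝕜 v)
    {s : Set ι} {i : ι} (hi : i ∉ s) {x : E} (hx : x ∈ Submodule.span 𝕜 (v '' s)) :
    ⟪v i, x⟫_𝕜 = 0 := by
  have hle : Submodule.span 𝕜 (v '' s) ≤ (𝕜 ∙ v i)ᗮ := by
    rw [Submodule.span_le]
    rintro _ ⟨j, hj, rfl⟩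
    exact Submodule.mem_orthogonal_singleton_iff_inner_right.mpr
      (hv.2 (ne_of_mem_of_not_mem hj hi).symm)
  exact Submodule.mem_orthogonal_singleton_iff_inner_right.mp (hle hx)

theorem norm_sq_apply_eq_sum {ι : Type*} [Fintype ι] (e : OrthonormalBasis ι 𝕜 E) {a : E →L[𝕜] F}
    (he : Pairwise fun i j => ⟪a (e i), a (e j)⟫_𝕜 = 0) (x : E) :
    ‖a x‖ ^ 2 = ∑ i, ‖a (e i)‖ ^ 2 * ‖⟪e i, x⟫_𝕜‖ ^ 2 := by
  have hax : a x = ∑ i, ⟪e i, x⟫_𝕜 • a (e i) := by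
    conv_lhs => rw [← e.sum_repr' x, map_sum]
    simp only [map_smul]
  have horth : Pairwise fun i j => ⟪⟪e i, x⟫_𝕜 • a (e i), ⟪e j, x⟫_𝕜 • a (e j)⟫_𝕜 = 0 :=
    fun i j hij => by simp [inner_smul_left, inner_smul_right, he hij]
  rw [hax, norm_sq_sum_of_pairwise_inner_eq_zero horth]
  simp only [norm_smul, mul_pow, mul_comm]

theorem approxNumber_eq_norm_apply {m : ℕ} (e : OrthonormalBasis (Fin m) 𝕜 E) {a : E →L[𝕜] F}
    (he : Pairwise fun i j => ⟪a (e i), a (e j)⟫_𝕜 = 0) (hanti : Antitone fun i => ‖a (e i)‖)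
    (i : Fin m) : approxNumber a i = ‖a (e i)‖₊ := by
  refine le_antisymm ?_ ?_
  · refine approxNumber_le_of_forall_mem_orthogonal (S := Submodule.span 𝕜 (e '' Finset.Iio i))
      (by simp [rank_span_image_finset e.orthonormal.linearIndependent]) fun x hx => ?_
    refine le_of_sq_le_sq ?_ (by positivity)
    rw [norm_sq_apply_eq_sum e he, mul_pow, ← e.sum_sq_norm_inner_right x, Finset.mul_sum]
    refine Finset.sum_le_sum fun l _ => ?_
    rcases lt_or_ge l i with hl | hl
    · have hxl : ⟪e l, x⟫_𝕜 = 0 :=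
        hx _ (Submodule.subset_span (Set.mem_image_of_mem e (by simpa using hl)))
      simp [hxl]
    · gcongr
      exact hanti hl
  · refine le_approxNumber_of_forall_mem (S := Submodule.span 𝕜 (e '' Finset.Iic i))
      (by simp [rank_span_image_finset e.orthonormal.linearIndependent]) fun x hx => ?_
    refine le_of_sq_le_sq ?_ (norm_nonneg _)
    rw [norm_sq_apply_eq_sum e he, mul_pow, ← e.sum_sq_norm_inner_right x, Finset.mul_sum]
    refine Finset.sum_le_sum fun l _ => ?_
    rcases le_or_gt l i with hl | hl
    · gcongr
      exact hanti hl
    · have hxl : ⟪e l, x⟫_𝕜 = 0 :=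
        inner_eq_zero_of_mem_span_image e.orthonormal (by simpa using hl) hx
      simp [hxl]

theorem exists_orthonormalBasis_norm_apply_eq_approxNumber [FiniteDimensional 𝕜 E] [CompleteSpace F]
    (a : E →L[𝕜] F) : ∃ e : OrthonormalBasis (Fin (Module.finrank 𝕜 E)) 𝕜 E,
      (Pairwise fun i j => ⟪a (e i), a (e j)⟫_𝕜 = 0) ∧
        ∀ i : Fin (Module.finrank 𝕜 E), approxNumber a i = ‖a (e i)‖₊ := by
  have := FiniteDimensional.complete 𝕜 E
  have hT : ((a.adjoint ∘L a : E →L[𝕜] E) : E →ₗ[𝕜] E).IsSymmetric :=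
    a.isPositive_adjoint_comp_self.isSymmetric
  let e := hT.eigenvectorBasis rfl
  have hinner : ∀ i j, ⟪a (e i), a (e j)⟫_𝕜 = (hT.eigenvalues rfl j : 𝕜) * ⟪e i, e j⟫_𝕜 := by
    intro i j
    rw [← ContinuousLinearMap.adjoint_inner_right, ← inner_smul_right]
    exact congrArg _ (hT.apply_eigenvectorBasis rfl j)
  have horth : Pairwise fun i j => ⟪a (e i), a (e j)⟫_𝕜 = 0 := fun i j hij => by
    simp only [hinner, e.orthonormal.2 hij, mul_zero]
  have hnorm : ∀ i, ‖a (e i)‖ ^ 2 = hT.eigenvalues rfl i := fun i => by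
    have h := hinner i i
    rw [inner_self_eq_norm_sq_to_K, e.inner_eq_one, mul_one] at h
    exact_mod_cast h
  refine ⟨e, horth, fun i => (approxNumber_eq_norm_apply e horth (fun i j hij => ?_) i)⟩
  refine le_of_sq_le_sq ?_ (norm_nonneg _)
  simpa only [hnorm] using hT.eigenvalues_antitone rfl hij

end SingularValues

section KyFan

variable {𝕜 E F : Type*} [RCLike 𝕜] [NormedAddCommGroup E] [InnerProductSpace 𝕜 E]
  [NormedAddCommGroup F] [InnerProductSpace 𝕜 F]

theorem nnnorm_trace_le_sum_approxNumber [FiniteDimensional 𝕜 E] (a : E →L[𝕜] E) :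
    ‖LinearMap.trace 𝕜 E a‖₊ ≤ ∑ j ∈ Finset.range (Module.finrank 𝕜 E), approxNumber a j := by
  have := FiniteDimensional.complete 𝕜 E
  obtain ⟨e, -, he⟩ := exists_orthonormalBasis_norm_apply_eq_approxNumber a
  rw [LinearMap.trace_eq_sum_inner (a : E →ₗ[𝕜] E) e, Finset.sum_range]
  refine nnnorm_sum_le_of_le _ fun j _ => ?_
  simpa [he j] using nnnorm_inner_le_nnnorm (𝕜 := 𝕜) (e j) (a (e j))

theorem exists_linearIsometry_basisFun_eq {k : ℕ} {v : Fin k → E} (hv : Orthonormal 𝕜 v) :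
    ∃ V : EuclideanSpace 𝕜 (Fin k) →ₗᵢ[𝕜] E,
      ∀ j, V (EuclideanSpace.basisFun (Fin k) 𝕜 j) = v j := by
  let e := EuclideanSpace.basisFun (Fin k) 𝕜
  have hVe : ∀ j, e.toBasis.constr 𝕜 v (e j) = v j := fun j => by
    rw [← e.coe_toBasis, e.toBasis.constr_basis]
  refine ⟨LinearMap.isometryOfOrthonormal (v := e.toBasis) (e.toBasis.constr 𝕜 v) ?_ ?_, hVe⟩
  · rw [e.coe_toBasis]
    exact e.orthonormal
  · convert hv with j
    ext j
    exact e.toBasis.constr_basis ..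

theorem nnnorm_sum_inner_le_sum_approxNumber [CompleteSpace F] (a : E →L[𝕜] F) {k : ℕ}
    {u : Fin k → F} {v : Fin k → E} (hu : Orthonormal 𝕜 u) (hv : Orthonormal 𝕜 v) :
    ‖∑ j, ⟪u j, a (v j)⟫_𝕜‖₊ ≤ ∑ j ∈ Finset.range k, approxNumber a j := by
  obtain ⟨U, hU⟩ := exists_linearIsometry_basisFun_eq hu
  obtain ⟨V, hV⟩ := exists_linearIsometry_basisFun_eq hv
  let e := EuclideanSpace.basisFun (Fin k) 𝕜
  let U' := U.toContinuousLinearMap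
  let V' := V.toContinuousLinearMap
  let c : EuclideanSpace 𝕜 (Fin k) →L[𝕜] EuclideanSpace 𝕜 (Fin k) := U'.adjoint ∘L a ∘L V'
  have htrace : LinearMap.trace 𝕜 (EuclideanSpace 𝕜 (Fin k)) c = ∑ j, ⟪u j, a (v j)⟫_𝕜 := by
    rw [LinearMap.trace_eq_sum_inner _ e]
    refine Finset.sum_congr rfl fun j _ => ?_
    calc ⟪e j, c (e j)⟫_𝕜 = ⟪U (e j), a (V (e j))⟫_𝕜 := U'.adjoint_inner_right _ _
      _ = ⟪u j, a (v j)⟫_𝕜 := by rw [hU, hV]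
  have hU' : ‖U'.adjoint‖₊ ≤ 1 := by
    rw [LinearIsometryEquiv.nnnorm_map]
    exact U.norm_toContinuousLinearMap_le
  have hle : ∀ j, approxNumber c j ≤ approxNumber a j := fun j =>
    calc approxNumber c j ≤ ‖U'.adjoint‖₊ * approxNumber (a ∘L V') j :=
          approxNumber_comp_le_left _ _ j
      _ ≤ 1 * (approxNumber a j * ‖V'‖₊) := by
          gcongr
          exact approxNumber_comp_le_right _ _ j
      _ ≤ approxNumber a j := by
          rw [one_mul]
          exact mul_le_of_le_one_right' V.norm_toContinuousLinearMap_le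
  calc ‖∑ j, ⟪u j, a (v j)⟫_𝕜‖₊ ≤ ∑ j ∈ Finset.range k, approxNumber c j := by
        simpa only [htrace, finrank_euclideanSpace_fin] using nnnorm_trace_le_sum_approxNumber c
    _ ≤ ∑ j ∈ Finset.range k, approxNumber a j := by
        gcongr with j
        exact hle j

theorem exists_orthonormal_inner_eq_approxNumber_of_finiteDimensional [FiniteDimensional 𝕜 E]
    [CompleteSpace F] {f : E →L[𝕜] F} {k : ℕ} (hk : ∀ j < k, approxNumber f j ≠ 0) :
    ∃ (u : Fin k → F) (v : Fin k → E), Orthonormal 𝕜 u ∧ Orthonormal 𝕜 v ∧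
      ∀ j : Fin k, ⟪u j, f (v j)⟫_𝕜 = (approxNumber f j : ℝ) := by
  obtain ⟨e, horth, he⟩ := exists_orthonormalBasis_norm_apply_eq_approxNumber f
  have hkm : k ≤ Module.finrank 𝕜 E := by
    by_contra! h
    refine hk _ h (approxNumber_eq_zero_of_rank_le (Cardinal.lift_le_nat_iff.mp ?_))
    exact (lift_rank_range_le _).trans_eq (by rw [← Module.finrank_eq_rank, Cardinal.lift_natCast])
  have hs : ∀ j : Fin k, ((approxNumber f j : ℝ) : 𝕜) ≠ 0 := fun j => by
    exact_mod_cast hk j j.2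
  let v : Fin k → E := fun j => e (j.castLE hkm)
  have hv : ∀ i j, ⟪f (v i), f (v j)⟫_𝕜 =
      if i = j then ((approxNumber f i : ℝ) : 𝕜) ^ 2 else 0 := by
    intro i j
    split_ifs with hij
    · rw [hij, inner_self_eq_norm_sq_to_K, ← coe_nnnorm, ← he, Fin.val_castLE]
    · exact horth fun h => hij (Fin.castLE_injective hkm h)
  refine ⟨fun j => ((approxNumber f j : ℝ) : 𝕜)⁻¹ • f (v j), v, ?_,
    e.orthonormal.comp _ (Fin.castLE_injective hkm), fun j => ?_⟩
  · refine orthonormal_iff_ite.mpr fun i j => ?_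
    rw [inner_smul_left, inner_smul_right, hv]
    split_ifs with hij
    · subst hij
      rw [map_inv₀, RCLike.conj_ofReal]
      field_simp [hs i]
    · simp only [mul_zero]
  · rw [inner_smul_left, hv, if_pos rfl, map_inv₀, RCLike.conj_ofReal]
    field_simp [hs j]

theorem exists_orthonormal_inner_eq_approxNumber [CompleteSpace E] [CompleteSpace F]
    {f : E →L[𝕜] F} (hf : LinearMap.rank (f : E →ₗ[𝕜] F) < Cardinal.aleph0) {k : ℕ}
    (hk : ∀ j < k, approxNumber f j ≠ 0) :
    ∃ (u : Fin k → F) (v : Fin k → E), Orthonormal 𝕜 u ∧ Orthonormal 𝕜 v ∧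
      ∀ j : Fin k, ⟪u j, f (v j)⟫_𝕜 = (approxNumber f j : ℝ) := by
  let U := LinearMap.range (f.adjoint : F →ₗ[𝕜] E)
  have : FiniteDimensional 𝕜 U := by
    obtain ⟨n, hn⟩ := Cardinal.lt_aleph0.mp hf
    exact Module.rank_lt_aleph0_iff.mp ((rank_adjoint_le hn.le).trans_lt Cardinal.natCast_lt_aleph0)
  have hU : ∀ x ∈ Uᗮ, f x = 0 := fun x hx => by
    rwa [f.adjoint.orthogonal_range, ContinuousLinearMap.adjoint_adjoint] at hx
  simp only [← approxNumber_comp_subtypeL hU] at hk ⊢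
  obtain ⟨u, v, hu, hv, huv⟩ := exists_orthonormal_inner_eq_approxNumber_of_finiteDimensional hk
  exact ⟨u, fun j => v j, hu, hv.comp_linearIsometry U.subtypeₗᵢ, huv⟩

theorem sum_approxNumber_le_of_rank_lt [CompleteSpace E] [CompleteSpace F]
    {f : E →L[𝕜] F} (hf : LinearMap.rank (f : E →ₗ[𝕜] F) < Cardinal.aleph0) (b : E →L[𝕜] F)
    (k : ℕ) :
    ∑ j ∈ Finset.range k, approxNumber f j ≤
      ∑ j ∈ Finset.range k, approxNumber (f - b) j + ∑ j ∈ Finset.range k, approxNumber b j := by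
  induction k with
  | zero => simp
  | succ k ih =>
    rcases eq_or_ne (approxNumber f k) 0 with h0 | h0
    · simp only [Finset.sum_range_succ, h0, add_zero]
      exact ih.trans (by gcongr <;> exact le_self_add)
    obtain ⟨u, v, hu, hv, huv⟩ := exists_orthonormal_inner_eq_approxNumber hf (k := k + 1)
      fun j hj => ((pos_iff_ne_zero.mpr h0).trans_le
        (approxNumber_antitone f (Nat.lt_succ_iff.mp hj))).ne'
    have hsum : ∑ j, ⟪u j, f (v j)⟫_𝕜 =
        ((∑ j ∈ Finset.range (k + 1), approxNumber f j : ℝ≥0) : ℝ) := by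
      simp [huv, Finset.sum_range]
    have hnorm : ‖∑ j, ⟪u j, f (v j)⟫_𝕜‖₊ = ∑ j ∈ Finset.range (k + 1), approxNumber f j := by
      rw [hsum]
      exact NNReal.eq (RCLike.norm_of_nonneg (NNReal.coe_nonneg _))
    have hsplit : ∑ j, ⟪u j, f (v j)⟫_𝕜 =
        ∑ j, ⟪u j, (f - b) (v j)⟫_𝕜 + ∑ j, ⟪u j, b (v j)⟫_𝕜 := by
      simp only [sub_apply, inner_sub_right, Finset.sum_sub_distrib, sub_add_cancel]
    rw [← hnorm, hsplit]
    exact (nnnorm_add_le _ _).trans (add_le_add (nnnorm_sum_inner_le_sum_approxNumber _ hu hv)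
      (nnnorm_sum_inner_le_sum_approxNumber _ hu hv))

theorem sum_approxNumber_add_le [CompleteSpace E] [CompleteSpace F]
    {a b : E →L[𝕜] F} (hab : Tendsto (approxNumber (a + b)) atTop (𝓝 0)) (k : ℕ) :
    ∑ j ∈ Finset.range k, approxNumber (a + b) j ≤
      ∑ j ∈ Finset.range k, approxNumber a j + ∑ j ∈ Finset.range k, approxNumber b j := by
  have hcont : Continuous fun x : E →L[𝕜] F => ∑ j ∈ Finset.range k, approxNumber x j :=
    continuous_finsetSum _ fun j _ => continuous_approxNumber j
  let S : Set (E →L[𝕜] F) := {x | ∑ j ∈ Finset.range k, approxNumber x j ≤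
    ∑ j ∈ Finset.range k, approxNumber (x - b) j + ∑ j ∈ Finset.range k, approxNumber b j}
  have hS : IsClosed S := isClosed_le hcont ((hcont.comp (continuous_sub_right b)).add_const _)
  have hmem : a + b ∈ S := closure_minimal (fun f hf => sum_approxNumber_le_of_rank_lt hf b k) hS
    (mem_closure_rank_lt_of_tendsto_approxNumber hab)
  simpa only [S, Set.mem_ofPred_eq, add_sub_cancel_right] using hmem

end KyFan

section Compact

theorem isCompactOperator_of_rank_lt_aleph0 {𝕜 E F : Type*} [NontriviallyNormedField 𝕜]
    [LocallyCompactSpace 𝕜] [NormedAddCommGroup E] [NormedSpace 𝕜 E] [NormedAddCommGroup F]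
    [NormedSpace 𝕜 F] {f : E →L[𝕜] F}
    (hf : LinearMap.rank (f : E →ₗ[𝕜] F) < Cardinal.aleph0) : IsCompactOperator f := by
  let R := LinearMap.range (f : E →ₗ[𝕜] F)
  have : FiniteDimensional 𝕜 R := Module.rank_lt_aleph0_iff.mp hf
  have : ProperSpace R := FiniteDimensional.proper 𝕜 R
  exact (isCompactOperator_of_locallyCompactSpace_rng R.subtypeL).comp_clm
    (f.codRestrict R fun x => ⟨x, rfl⟩)

variable {𝕜 E F : Type*} [RCLike 𝕜] [NormedAddCommGroup E] [NormedAddCommGroup F]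
  [InnerProductSpace 𝕜 F]

section NormedSpace

variable [NormedSpace 𝕜 E]

theorem exists_approxNumber_le_of_isCompactOperator {a : E →L[𝕜] F} (ha : IsCompactOperator a)
    {ε : ℝ≥0} (hε : 0 < ε) : ∃ n, approxNumber a n ≤ ε := by
  obtain ⟨K, hK, haK⟩ := ha.image_closedBall_subset_compact (f := (a : E →ₗ[𝕜] F)) 1
  obtain ⟨t, -, ht, hKt⟩ := hK.finite_cover_balls (NNReal.coe_pos.mpr hε)
  let S := Submodule.span 𝕜 t
  have : FiniteDimensional 𝕜 S := FiniteDimensional.span_of_finite 𝕜 ht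
  refine ⟨Module.finrank 𝕜 S, (approxNumber_le (f := S.starProjection ∘L a) ?_).trans ?_⟩
  · rw [Module.finrank_eq_rank]
    refine (LinearMap.rank_comp_le_left (a : E →ₗ[𝕜] F) (S.starProjection : F →ₗ[𝕜] F)).trans_eq ?_
    rw [LinearMap.rank, Submodule.range_starProjection]
  · refine ContinuousLinearMap.opNorm_le_of_unit_norm ε.2 fun x hx => ?_
    have haxK : a x ∈ K := haK ⟨x, by simp [hx], rfl⟩
    obtain ⟨y, hy, hxy⟩ := Set.mem_iUnion₂.mp (hKt haxK)
    calc ‖a x - S.starProjection (a x)‖ = ⨅ z : S, ‖a x - z‖ := Submodule.starProjection_minimal _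
      _ ≤ ‖a x - y‖ := ciInf_le ⟨0, Set.forall_mem_range.mpr fun _ => norm_nonneg _⟩
          (⟨y, Submodule.subset_span hy⟩ : S)
      _ ≤ ε := (mem_ball_iff_norm.mp hxy).le

theorem tendsto_approxNumber_of_isCompactOperator {a : E →L[𝕜] F} (ha : IsCompactOperator a) :
    Tendsto (approxNumber a) atTop (𝓝 0) := by
  refine tendsto_atTop_isGLB (approxNumber_antitone a) ⟨fun _ _ => zero_le, fun r hr => ?_⟩
  refine le_of_forall_gt_imp_ge_of_dense fun ε hε => ?_
  obtain ⟨n, hn⟩ := exists_approxNumber_le_of_isCompactOperator ha hε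
  exact (hr ⟨n, rfl⟩).trans hn

theorem isCompactOperator_iff_tendsto_approxNumber [CompleteSpace F] {a : E →L[𝕜] F} :
    IsCompactOperator a ↔ Tendsto (approxNumber a) atTop (𝓝 0) := by
  refine ⟨tendsto_approxNumber_of_isCompactOperator, fun ha => ?_⟩
  have hclosed : IsClosed {b : E →L[𝕜] F | IsCompactOperator b} :=
    isClosed_setOfPred_isCompactOperator
  exact closure_minimal (fun _ hf => isCompactOperator_of_rank_lt_aleph0 hf) hclosed
    (mem_closure_rank_lt_of_tendsto_approxNumber ha)

end NormedSpace

theorem isCompactOperator_adjoint [InnerProductSpace 𝕜 E] [CompleteSpace E] [CompleteSpace F]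
    {a : E →L[𝕜] F} (ha : IsCompactOperator a) : IsCompactOperator a.adjoint := by
  rw [isCompactOperator_iff_tendsto_approxNumber] at ha ⊢
  rwa [funext (approxNumber_adjoint a)]

end Compact

/-! ### Eigenvalues and approximation numbers -/

section Spectral

variable {𝕜 E : Type*} [RCLike 𝕜] [NormedAddCommGroup E] [InnerProductSpace 𝕜 E]

theorem exists_re_inner_eq_sum_of_mem_iSup_eigenspace {T : E →ₗ[𝕜] E} (hT : T.IsSymmetric)
    {S : Set ℝ} {x : E} (hx : x ∈ ⨆ μ ∈ S, Module.End.eigenspace T (μ : 𝕜)) :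
    ∃ (s : Finset S) (f : S → E), RCLike.re ⟪T x, x⟫_𝕜 = ∑ μ ∈ s, (μ : ℝ) * ‖f μ‖ ^ 2 ∧
      ‖x‖ ^ 2 = ∑ μ ∈ s, ‖f μ‖ ^ 2 := by
  rw [iSup_subtype', Submodule.mem_iSup_iff_exists_finsupp] at hx
  obtain ⟨f, hf, rfl⟩ := hx
  have horth : OrthogonalFamily 𝕜 (fun μ : S => Module.End.eigenspace T ((μ : ℝ) : 𝕜))
      fun μ => (Module.End.eigenspace T ((μ : ℝ) : 𝕜)).subtypeₗᵢ :=
    hT.orthogonalFamily_eigenspaces.comp (RCLike.ofReal_injective.comp Subtype.val_injective)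
  let g : ∀ μ : S, Module.End.eigenspace T ((μ : ℝ) : 𝕜) := fun μ => ⟨f μ, hf μ⟩
  have hTf : T (f.sum fun _ y => y) = ∑ μ ∈ f.support, ((((μ : ℝ) : 𝕜) • g μ :) : E) := by
    simp only [Finsupp.sum, map_sum, fun μ => Module.End.mem_eigenspace_iff.mp (hf μ)]
    rfl
  refine ⟨f.support, f, ?_, horth.norm_sum g f.support⟩
  have hinner := horth.inner_sum (fun μ => ((μ : ℝ) : 𝕜) • g μ) g f.support
  rw [hTf]
  refine (congrArg RCLike.re hinner).trans ?_
  rw [map_sum]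
  refine Finset.sum_congr rfl fun μ _ => ?_
  rw [inner_smul_left, RCLike.conj_ofReal, RCLike.re_ofReal_mul, inner_self_eq_norm_sq]
  rfl

theorem mul_norm_sq_le_re_inner_of_mem_iSup_eigenspace {T : E →ₗ[𝕜] E} (hT : T.IsSymmetric)
    {S : Set ℝ} {t : ℝ} (ht : t ∈ lowerBounds S) {x : E}
    (hx : x ∈ ⨆ μ ∈ S, Module.End.eigenspace T (μ : 𝕜)) :
    t * ‖x‖ ^ 2 ≤ RCLike.re ⟪T x, x⟫_𝕜 := by
  obtain ⟨s, f, hinner, hnorm⟩ := exists_re_inner_eq_sum_of_mem_iSup_eigenspace hT hx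
  rw [hinner, hnorm, Finset.mul_sum]
  gcongr with μ
  exact ht μ.2

theorem re_inner_le_mul_norm_sq_of_mem_iSup_eigenspace {T : E →ₗ[𝕜] E} (hT : T.IsSymmetric)
    {S : Set ℝ} {t : ℝ} (ht : t ∈ upperBounds S) {x : E}
    (hx : x ∈ ⨆ μ ∈ S, Module.End.eigenspace T (μ : 𝕜)) :
    RCLike.re ⟪T x, x⟫_𝕜 ≤ t * ‖x‖ ^ 2 := by
  obtain ⟨s, f, hinner, hnorm⟩ := exists_re_inner_eq_sum_of_mem_iSup_eigenspace hT hx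
  rw [hinner, hnorm, Finset.mul_sum]
  gcongr with μ
  exact ht μ.2

theorem isOrtho_iSup_eigenspace {T : E →ₗ[𝕜] E} (hT : T.IsSymmetric) {S S' : Set ℝ}
    (hS : Disjoint S S') : (⨆ μ ∈ S, Module.End.eigenspace T (μ : 𝕜)) ⟂
      ⨆ μ ∈ S', Module.End.eigenspace T (μ : 𝕜) := by
  simp only [Submodule.isOrtho_iSup_left, Submodule.isOrtho_iSup_right]
  exact fun ν hν μ hμ => hT.orthogonalFamily_eigenspaces.isOrtho fun h =>
    hS.ne_of_mem hμ hν (RCLike.ofReal_injective h)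

theorem iSup_eigenspace_le_sup_of_isSymmetric {T : E →ₗ[𝕜] E} (hT : T.IsSymmetric) (S : Set ℝ) :
    ⨆ μ : 𝕜, Module.End.eigenspace T μ ≤ (⨆ μ ∈ S, Module.End.eigenspace T (μ : 𝕜)) ⊔
      ⨆ μ ∈ Sᶜ, Module.End.eigenspace T (μ : 𝕜) := by
  rw [← iSup_union, Set.union_compl_self]
  simp only [Set.mem_univ, iSup_pos]
  refine iSup_le fun μ => ?_
  by_cases hμ : Module.End.HasEigenvalue T μ
  · exact (RCLike.conj_eq_iff_re.mp (hT.conj_eigenvalue_eq_self hμ)) ▸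
      le_iSup (fun ν : ℝ => Module.End.eigenspace T (ν : 𝕜)) (RCLike.re μ)
  · rw [Module.End.hasEigenvalue_iff, not_not] at hμ
    exact hμ.trans_le bot_le

variable [CompleteSpace E]

theorem orthogonal_iSup_eigenspace_eq_topologicalClosure {T : E →L[𝕜] E}
    (hT : (T : E →ₗ[𝕜] E).IsSymmetric) (hc : IsCompactOperator T) (S : Set ℝ) :
    (⨆ μ ∈ S, Module.End.eigenspace (T : E →ₗ[𝕜] E) (μ : 𝕜))ᗮ =
      (⨆ μ ∈ Sᶜ, Module.End.eigenspace (T : E →ₗ[𝕜] E) (μ : 𝕜)).topologicalClosure := by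
  set U := ⨆ μ ∈ S, Module.End.eigenspace (T : E →ₗ[𝕜] E) (μ : 𝕜)
  set W := ⨆ μ ∈ Sᶜ, Module.End.eigenspace (T : E →ₗ[𝕜] E) (μ : 𝕜)
  have hWU : W.topologicalClosure ≤ Uᗮ := Submodule.topologicalClosure_minimal _
    (isOrtho_iSup_eigenspace hT disjoint_compl_right).symm U.isClosed_orthogonal
  have hbot : Uᗮ ⊓ Wᗮ = ⊥ := by
    rw [Submodule.inf_orthogonal, eq_bot_iff,
      ← ContinuousLinearMap.orthogonalComplement_iSup_eigenspaces_eq_bot hc hT]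
    exact Submodule.orthogonal_le (iSup_eigenspace_le_sup_of_isSymmetric hT S)
  have : CompleteSpace W.topologicalClosure := W.isClosed_topologicalClosure.completeSpace_coe
  refine le_antisymm (fun x hx => ?_) hWU
  obtain ⟨y, hy, z, hz, rfl⟩ := W.topologicalClosure.exists_add_mem_mem_orthogonal x
  rw [Submodule.orthogonal_closure] at hz
  have hz0 : z ∈ Uᗮ ⊓ Wᗮ := ⟨by simpa using Submodule.sub_mem _ hx (hWU hy), hz⟩
  rw [hbot, Submodule.mem_bot] at hz0
  rwa [hz0, add_zero]

end Spectral

section UpperEigenspace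

variable {E F : Type*} [NormedAddCommGroup E] [InnerProductSpace ℂ E] [CompleteSpace E]
  [NormedAddCommGroup F] [InnerProductSpace ℂ F]

theorem re_inner_le_of_mem_upperEigenspace_orthogonal {T : E →L[ℂ] E}
    (hT : (T : E →ₗ[ℂ] E).IsSymmetric) (hc : IsCompactOperator T) {t : ℝ} {x : E}
    (hx : x ∈ (upperEigenspace T t)ᗮ) : RCLike.re ⟪T x, x⟫_ℂ ≤ t * ‖x‖ ^ 2 := by
  have hclosed : IsClosed {y : E | RCLike.re ⟪T y, y⟫_ℂ ≤ t * ‖y‖ ^ 2} :=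
    isClosed_le (by fun_prop) (by fun_prop)
  refine closure_minimal (fun y hy => ?_) hclosed
    ((orthogonal_iSup_eigenspace_eq_topologicalClosure hT hc (Set.Ioi t)).le hx)
  exact re_inner_le_mul_norm_sq_of_mem_iSup_eigenspace hT (fun _ hμ => not_lt.mp hμ) hy

variable [CompleteSpace F]

theorem approxNumber_le_of_rank_upperEigenspace_le {a : E →L[ℂ] F} (ha : IsCompactOperator a)
    {t : ℝ≥0} {n : ℕ} (hn : Module.rank ℂ (upperEigenspace (a.adjoint ∘L a) (t ^ 2)) ≤ n) :
    approxNumber a n ≤ t := by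
  refine approxNumber_le_of_forall_mem_orthogonal hn fun x hx => ?_
  refine le_of_sq_le_sq ?_ (by positivity)
  rw [mul_pow, a.apply_norm_sq_eq_inner_adjoint_left]
  exact re_inner_le_of_mem_upperEigenspace_orthogonal a.isPositive_adjoint_comp_self.isSymmetric
    (ha.clm_comp a.adjoint) hx

theorem le_approxNumber_of_lt_rank_upperEigenspace {a : E →L[ℂ] F} {t : ℝ≥0} {n : ℕ}
    (hn : n < Module.rank ℂ (upperEigenspace (a.adjoint ∘L a) (t ^ 2))) : t ≤ approxNumber a n := by
  refine le_approxNumber_of_forall_mem hn fun x hx => ?_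
  refine le_of_sq_le_sq ?_ (by positivity)
  rw [mul_pow, a.apply_norm_sq_eq_inner_adjoint_left]
  exact mul_norm_sq_le_re_inner_of_mem_iSup_eigenspace
    a.isPositive_adjoint_comp_self.isSymmetric (fun _ => le_of_lt) hx

end UpperEigenspace

section FunctionalCalculus

variable {E : Type*} [NormedAddCommGroup E]

theorem mem_spectrum_of_apply_eq_smul [NormedSpace ℂ E] {T : E →L[ℂ] E} {x : E} (hx0 : x ≠ 0)
    {μ : ℝ} (hx : T x = (μ : ℂ) • x) : μ ∈ spectrum ℝ T := by
  intro hunit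
  obtain ⟨S, hS⟩ := hunit.exists_left_inv
  have hker : (algebraMap ℝ (E →L[ℂ] E) μ - T) x = 0 := by
    simp [Algebra.algebraMap_eq_smul_one, hx]
  refine hx0 ?_
  rw [← one_apply_eq_self (F := E →L[ℂ] E) x, ← hS, mul_apply_eq_comp, hker, map_zero]

variable [InnerProductSpace ℂ E] [CompleteSpace E]

theorem cfcHom_apply_eq_smul {T : E →L[ℂ] E} (hT : IsSelfAdjoint T) {x : E} {μ : spectrum ℝ T}
    (hx : T x = ((μ : ℝ) : ℂ) • x) (f : C(spectrum ℝ T, ℝ)) :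
    cfcHom hT f x = (f μ : ℂ) • x := by
  induction f using ContinuousMap.induction_on_of_compact with
  | const r =>
    have hconst : cfcHom hT (.const _ r) = algebraMap ℝ (E →L[ℂ] E) r :=
      AlgHomClass.commutes (cfcHom hT) r
    simp [hconst, Algebra.algebraMap_eq_smul_one]
  | id => rwa [cfcHom_id]
  | star_id => rwa [map_star, cfcHom_id, hT.star_eq]
  | add f g hf hg =>
    rw [map_add, add_apply, hf, hg, ContinuousMap.add_apply, Complex.ofReal_add, add_smul]
  | mul f g hf hg =>
    rw [map_mul, mul_apply_eq_comp, hg, map_smul, hf, smul_comm, smul_smul,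
      ContinuousMap.mul_apply, Complex.ofReal_mul]
  | frequently f hf =>
    have hclosed : IsClosed {g : C(spectrum ℝ T, ℝ) | cfcHom hT g x = (g μ : ℂ) • x} := by
      have := cfcHom_continuous (R := ℝ) hT
      exact isClosed_eq (by fun_prop) (by fun_prop)
    exact hf.mem_of_closed hclosed

theorem cfc_apply_eq_smul {T : E →L[ℂ] E} (hT : IsSelfAdjoint T) {f : ℝ → ℝ}
    (hf : ContinuousOn f (spectrum ℝ T)) {x : E} {μ : ℝ} (hx : T x = (μ : ℂ) • x) :
    cfc f T x = (f μ : ℂ) • x := by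
  rcases eq_or_ne x 0 with rfl | hx0
  · simp only [map_zero, smul_zero]
  rw [cfc_apply f T]
  exact cfcHom_apply_eq_smul hT (μ := ⟨μ, mem_spectrum_of_apply_eq_smul hx0 hx⟩) hx _

theorem upperEigenspace_le_rpow {T : E →L[ℂ] E} (hT : 0 ≤ T) {r t : ℝ} (hr : 0 < r)
    (ht : 0 ≤ t) : upperEigenspace T t ≤ upperEigenspace (T ^ r) (t ^ r) := by
  refine iSup₂_le fun μ hμ => le_iSup₂_of_le (μ ^ r) (Real.rpow_lt_rpow ht hμ hr) fun x hx => ?_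
  rw [Module.End.mem_eigenspace_iff] at hx ⊢
  rw [CFC.rpow_eq_cfc_real hT]
  exact cfc_apply_eq_smul hT.isSelfAdjoint (Real.continuous_rpow_const hr.le).continuousOn hx

theorem upperEigenspace_rpow {T : E →L[ℂ] E} (hT : 0 ≤ T) {r t : ℝ} (hr : 0 < r)
    (ht : 0 ≤ t) : upperEigenspace (T ^ r) (t ^ r) = upperEigenspace T t := by
  refine le_antisymm ?_ (upperEigenspace_le_rpow hT hr ht)
  have hinv := upperEigenspace_le_rpow (T := T ^ r) CFC.rpow_nonneg (inv_pos.mpr hr)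
    (Real.rpow_nonneg ht r)
  rwa [CFC.rpow_rpow_of_exponent_nonneg T r r⁻¹ hr.le (inv_nonneg.mpr hr.le) hT,
    Real.rpow_rpow_inv ht hr.ne', mul_inv_cancel₀ hr.ne', CFC.rpow_one T hT] at hinv

theorem abs_rpow_eq_rpow_half (a : E →L[ℂ] E) {p : ℝ} (hp : 0 ≤ p) :
    CFC.abs a ^ p = (star a * a) ^ (p / 2) := by
  rw [CFC.abs, CFC.sqrt_eq_rpow, CFC.rpow_rpow_of_exponent_nonneg _ _ _ one_half_pos.le hp
    (star_mul_self_nonneg a), one_div_mul_eq_div]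

theorem upperEigenspace_abs_rpow (a : E →L[ℂ] E) {p t : ℝ} (hp : 0 < p) (ht : 0 ≤ t) :
    upperEigenspace (CFC.abs a ^ p) (t ^ p) = upperEigenspace (star a * a) (t ^ 2) := by
  rw [abs_rpow_eq_rpow_half a hp.le, ← upperEigenspace_rpow (star_mul_self_nonneg a) (half_pos hp)
    (sq_nonneg t), ← Real.rpow_natCast_mul ht, Nat.cast_ofNat, mul_div_cancel₀ _ two_ne_zero]

theorem exists_upperEigenspace_abs_rpow_eq (a : E →L[ℂ] E) {p t : ℝ} (hp : 0 < p) (ht : 0 ≤ t) :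
    ∃ τ : ℝ≥0, (τ : ℝ) ^ p = t ∧
      upperEigenspace (CFC.abs a ^ p) t = upperEigenspace (a.adjoint ∘L a) (τ ^ 2) := by
  have hroot : (t ^ p⁻¹) ^ p = t := Real.rpow_inv_rpow ht hp.ne'
  refine ⟨⟨t ^ p⁻¹, by positivity⟩, hroot, ?_⟩
  conv_lhs => rw [← hroot]
  exact upperEigenspace_abs_rpow a hp (by positivity)

theorem eigenvalueSeq_abs_rpow {a : E →L[ℂ] E} (ha : IsCompactOperator a) {p : ℝ} (hp : 0 < p)
    (n : ℕ) : eigenvalueSeq (CFC.abs a ^ p) n = (approxNumber a n : ℝ) ^ p := by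
  let S := {t : ℝ | 0 < t ∧ Module.rank ℂ (upperEigenspace (CFC.abs a ^ p) t) ≤ n}
  have hnonneg : (0 : ℝ) ≤ approxNumber a n ^ p := by positivity
  have hmem : ∀ t > (approxNumber a n : ℝ) ^ p, t ∈ S := by
    refine fun t ht => ⟨hnonneg.trans_lt ht, not_lt.mp fun hn => ht.not_ge ?_⟩
    obtain ⟨τ, rfl, hτ⟩ := exists_upperEigenspace_abs_rpow_eq a hp (hnonneg.trans ht.le)
    rw [hτ] at hn
    gcongr
    exact le_approxNumber_of_lt_rank_upperEigenspace hn
  have hlower : (approxNumber a n : ℝ) ^ p ∈ lowerBounds S := fun t ⟨ht, hn⟩ => by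
    obtain ⟨τ, rfl, hτ⟩ := exists_upperEigenspace_abs_rpow_eq a hp ht.le
    rw [hτ] at hn
    gcongr
    exact approxNumber_le_of_rank_upperEigenspace_le ha hn
  have hglb : IsGLB S ((approxNumber a n : ℝ) ^ p) :=
    ⟨hlower, fun _ hr => le_of_forall_gt_imp_ge_of_dense fun t ht => hr (hmem t ht)⟩
  exact hglb.csInf_eq ⟨_, hmem _ (lt_add_one _)⟩

end FunctionalCalculus

/-! ### Weighted sequence norms -/

section Sequences

variable {w x y l : ℕ → ℝ≥0} {p : ℝ}

theorem sum_range_mul_le_of_sum_range_le (hw : Antitone w)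
    (h : ∀ k, ∑ j ∈ Finset.range k, x j ≤ ∑ j ∈ Finset.range k, y j) (n : ℕ) :
    ∑ j ∈ Finset.range n, w j * x j ≤ ∑ j ∈ Finset.range n, w j * y j := by
  have hpartial : ∀ k, 0 ≤ ∑ j ∈ Finset.range k, ((y j : ℝ) - x j) := fun k => by
    rw [Finset.sum_sub_distrib, sub_nonneg]
    exact_mod_cast h k
  have hAbel : ∀ k, (w k : ℝ) * ∑ j ∈ Finset.range (k + 1), ((y j : ℝ) - x j) ≤
      ∑ j ∈ Finset.range (k + 1), (w j : ℝ) * ((y j : ℝ) - x j) := by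
    intro k
    induction k with
    | zero => simp
    | succ k ih =>
      have hstep : (w (k + 1) : ℝ) * ∑ j ∈ Finset.range (k + 1), ((y j : ℝ) - x j) ≤
          w k * ∑ j ∈ Finset.range (k + 1), ((y j : ℝ) - x j) :=
        mul_le_mul_of_nonneg_right (hw k.le_succ) (hpartial (k + 1))
      rw [Finset.sum_range_succ, Finset.sum_range_succ (fun j => (w j : ℝ) * ((y j : ℝ) - x j)),
        mul_add]
      linarith
  cases n with
  | zero => simp
  | succ n =>
    have hnonneg := (mul_nonneg (w n).coe_nonneg (hpartial (n + 1))).trans (hAbel n)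
    simp only [mul_sub, Finset.sum_sub_distrib, sub_nonneg] at hnonneg
    exact_mod_cast hnonneg

theorem mul_rpow_sub_one_mul_le {a b : ℝ} (ha : 0 ≤ a) (hb : 0 ≤ b) (hp : 1 ≤ p) :
    p * (a ^ (p - 1) * b) ≤ b ^ p + (p - 1) * a ^ p := by
  have hp0 := zero_lt_one.trans_le hp
  have hAMGM := Real.geom_mean_le_arith_mean2_weighted (w₁ := 1 - p⁻¹) (w₂ := p⁻¹)
    (sub_nonneg.mpr (inv_le_one_of_one_le₀ hp)) (inv_nonneg.mpr hp0.le)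
    (Real.rpow_nonneg ha p) (Real.rpow_nonneg hb p) (sub_add_cancel 1 p⁻¹)
  rw [← Real.rpow_mul ha, ← Real.rpow_mul hb, mul_sub, mul_one, mul_inv_cancel₀ hp0.ne',
    Real.rpow_one] at hAMGM
  calc p * (a ^ (p - 1) * b) ≤ p * ((1 - p⁻¹) * a ^ p + p⁻¹ * b ^ p) := by gcongr
    _ = b ^ p + (p - 1) * a ^ p := by field_simp; ring

theorem sum_range_mul_rpow_le_of_sum_range_le (hw : Antitone w) (hx : Antitone x)
    (h : ∀ k, ∑ j ∈ Finset.range k, x j ≤ ∑ j ∈ Finset.range k, y j) (hp : 1 ≤ p) (n : ℕ) :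
    ∑ j ∈ Finset.range n, w j * x j ^ p ≤ ∑ j ∈ Finset.range n, w j * y j ^ p := by
  have hanti : Antitone fun j => w j * x j ^ (p - 1) := fun i j hij =>
    mul_le_mul' (hw hij) (NNReal.rpow_le_rpow (hx hij) (sub_nonneg.mpr hp))
  have hpow : ∀ j, x j ^ (p - 1) * x j = x j ^ p := fun j => by
    nth_rw 2 [← NNReal.rpow_one (x j)]
    rw [← NNReal.rpow_add_of_nonneg _ (sub_nonneg.mpr hp) zero_le_one, sub_add_cancel]
  -- Abel summation compares `∑ w x ^ (p - 1) x` with `∑ w x ^ (p - 1) y`, and the tangent line of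
  -- `t ↦ t ^ p` at `x j` bounds the latter by `∑ w y ^ p` and `∑ w x ^ p`.
  have hAbel : ∑ j ∈ Finset.range n, w j * x j ^ p ≤
      ∑ j ∈ Finset.range n, w j * x j ^ (p - 1) * y j := by
    simpa only [mul_assoc, hpow] using sum_range_mul_le_of_sum_range_le hanti h n
  have htangent : p * ∑ j ∈ Finset.range n, ((w j * x j ^ (p - 1) * y j : ℝ≥0) : ℝ) ≤
      ∑ j ∈ Finset.range n, ((w j * y j ^ p : ℝ≥0) : ℝ) +
        (p - 1) * ∑ j ∈ Finset.range n, ((w j * x j ^ p : ℝ≥0) : ℝ) := by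
    rw [Finset.mul_sum, Finset.mul_sum, ← Finset.sum_add_distrib]
    refine Finset.sum_le_sum fun j _ => ?_
    have hterm := mul_le_mul_of_nonneg_left
      (mul_rpow_sub_one_mul_le (x j).coe_nonneg (y j).coe_nonneg hp) (w j).coe_nonneg
    push_cast
    linarith
  rw [← NNReal.coe_le_coe] at hAbel ⊢
  rw [NNReal.coe_sum, NNReal.coe_sum] at hAbel ⊢
  linarith [mul_le_mul_of_nonneg_left hAbel (zero_le_one.trans hp)]

/-- The weighted `ℓ^p` norm of a sequence of nonnegative reals, with values in `[0, ∞]`. For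
decreasing `w` and `x` this is the norm of the Lorentz sequence space. -/
def weightedNorm (w : ℕ → ℝ≥0) (p : ℝ) (x : ℕ → ℝ≥0) : ℝ≥0∞ :=
  (∑' j, (w j : ℝ≥0∞) * (x j : ℝ≥0∞) ^ p) ^ (1 / p)

theorem weightedNorm_mono (hp : 0 ≤ p) : Monotone (weightedNorm w p) := fun x y hxy => by
  unfold weightedNorm
  gcongr with j
  exact hxy j

theorem weightedNorm_const_mul (hp : 0 < p) (c : ℝ≥0) :
    weightedNorm w p (fun j => c * x j) = c * weightedNorm w p x := by
  simp only [weightedNorm, ENNReal.coe_mul, ENNReal.mul_rpow_of_nonneg _ _ hp.le,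
    mul_left_comm _ ((c : ℝ≥0∞) ^ p), ENNReal.tsum_mul_left]
  rw [ENNReal.mul_rpow_of_nonneg _ _ (one_div_nonneg.mpr hp.le), one_div,
    ENNReal.rpow_rpow_inv hp.ne']

theorem coe_rpow_mul_le_weightedNorm (hp : 0 < p) :
    ((w 0 ^ (1 / p) * x 0 : ℝ≥0) : ℝ≥0∞) ≤ weightedNorm w p x := by
  have hp' : 0 ≤ 1 / p := one_div_nonneg.mpr hp.le
  calc ((w 0 ^ (1 / p) * x 0 : ℝ≥0) : ℝ≥0∞) = ((w 0 : ℝ≥0∞) * (x 0 : ℝ≥0∞) ^ p) ^ (1 / p) := by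
        rw [ENNReal.mul_rpow_of_nonneg _ _ hp', ENNReal.coe_mul, ENNReal.coe_rpow_of_nonneg _ hp',
          one_div, ENNReal.rpow_rpow_inv hp.ne']
    _ ≤ weightedNorm w p x := ENNReal.rpow_le_rpow (ENNReal.le_tsum 0) hp'

theorem weightedNorm_add_le (w x y : ℕ → ℝ≥0) (hp : 1 ≤ p) :
    weightedNorm w p (x + y) ≤ weightedNorm w p x + weightedNorm w p y := by
  let μ := MeasureTheory.Measure.sum fun j => (w j : ℝ≥0∞) • MeasureTheory.Measure.dirac j
  have hnorm : ∀ z : ℕ → ℝ≥0, weightedNorm w p z = (∫⁻ j, (z j : ℝ≥0∞) ^ p ∂μ) ^ (1 / p) :=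
    fun z => by
      simp only [μ, weightedNorm, MeasureTheory.lintegral_sum_measure,
        MeasureTheory.lintegral_smul_measure, MeasureTheory.lintegral_dirac, smul_eq_mul]
  simpa only [hnorm, Pi.add_apply, ENNReal.coe_add] using
    ENNReal.lintegral_Lp_add_le (μ := μ) (f := fun j => (x j : ℝ≥0∞)) (g := fun j => (y j : ℝ≥0∞))
      (measurable_of_countable _).aemeasurable (measurable_of_countable _).aemeasurable hp

theorem weightedNorm_le_of_sum_range_le (hw : Antitone w) (hx : Antitone x)
    (h : ∀ k, ∑ j ∈ Finset.range k, x j ≤ ∑ j ∈ Finset.range k, y j) (hp : 1 ≤ p) :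
    weightedNorm w p x ≤ weightedNorm w p y := by
  have hp0 : 0 ≤ p := zero_le_one.trans hp
  refine ENNReal.rpow_le_rpow (ENNReal.tsum_le_of_sum_range_le fun n => ?_)
    (one_div_nonneg.mpr hp0)
  refine le_trans ?_ (ENNReal.sum_le_tsum (Finset.range n))
  simp only [← ENNReal.coe_rpow_of_nonneg _ hp0]
  exact_mod_cast sum_range_mul_rpow_le_of_sum_range_le hw hx h hp n

theorem lowerSemicontinuous_weightedNorm (w : ℕ → ℝ≥0) (hp : 0 ≤ p) :
    LowerSemicontinuous (weightedNorm w p) := by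
  have hp' : 0 ≤ 1 / p := one_div_nonneg.mpr hp
  refine ENNReal.continuous_rpow_const.comp_lowerSemicontinuous
    (lowerSemicontinuous_tsum fun j => Continuous.lowerSemicontinuous ?_)
    (ENNReal.monotone_rpow_of_nonneg hp')
  have hpow : Continuous fun x : ℕ → ℝ≥0 => (x j : ℝ≥0∞) ^ p :=
    ENNReal.continuous_rpow_const.comp (ENNReal.continuous_coe.comp (continuous_apply j))
  exact (ENNReal.continuous_const_mul ENNReal.coe_ne_top).comp hpow

theorem hasSum_tsub_succ (hl : Antitone l) (hlim : Tendsto l atTop (𝓝 0)) :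
    HasSum (fun i => l i - l (i + 1)) (l 0) := by
  rw [NNReal.hasSum_iff_tendsto_nat]
  have hsum : ∀ n, ∑ i ∈ Finset.range n, (l i - l (i + 1)) = l 0 - l n := fun n => by
    induction n with
    | zero => simp
    | succ n ih =>
      rw [Finset.sum_range_succ, ih, tsub_add_tsub_cancel (hl n.zero_le) (hl n.le_succ)]
  simpa only [hsum, tsub_zero] using tendsto_const_nhds.sub hlim

theorem tsum_tsub_succ_add (hl : Antitone l) (hlim : Tendsto l atTop (𝓝 0)) (j : ℕ) :
    ∑' k, ((l (j + k) - l (j + k + 1) : ℝ≥0) : ℝ≥0∞) = l j := by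
  refine (ENNReal.hasSum_coe.mpr (hasSum_tsub_succ (l := fun k => l (j + k)) ?_ ?_)).tsum_eq
  · exact fun m n hmn => hl (by gcongr)
  · simpa only [add_comm j] using (tendsto_add_atTop_iff_nat j).mpr hlim

theorem tsum_tsub_succ_mul_sum_range (w : ℕ → ℝ≥0) (hl : Antitone l)
    (hlim : Tendsto l atTop (𝓝 0)) :
    ∑' i, ((l i - l (i + 1) : ℝ≥0) : ℝ≥0∞) * ∑ j ∈ Finset.range (i + 1), (w j : ℝ≥0∞) =
      ∑' j, (w j : ℝ≥0∞) * l j := by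
  let f : ℕ × ℕ → ℝ≥0∞ := fun q => w q.1 * ((l (q.1 + q.2) - l (q.1 + q.2 + 1) : ℝ≥0) : ℝ≥0∞)
  calc ∑' i, ((l i - l (i + 1) : ℝ≥0) : ℝ≥0∞) * ∑ j ∈ Finset.range (i + 1), (w j : ℝ≥0∞)
      = ∑' i, ∑ q ∈ Finset.HasAntidiagonal.antidiagonal i, f q := by
        refine tsum_congr fun i => ?_
        rw [mul_comm, Finset.sum_mul,
          ← Finset.Nat.sum_antidiagonal_eq_sum_range_succ_mk
            (f := fun q => (w q.1 : ℝ≥0∞) * ((l i - l (i + 1) : ℝ≥0) : ℝ≥0∞))]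
        refine Finset.sum_congr rfl fun q hq => ?_
        rw [← Finset.HasAntidiagonal.mem_antidiagonal.mp hq]
    _ = ∑' q, f q := by
        rw [← Finset.HasAntidiagonal.sigmaAntidiagonalEquivProd.tsum_eq f, ENNReal.tsum_sigma']
        exact tsum_congr fun i =>
          (Finset.tsum_subtype' (Finset.HasAntidiagonal.antidiagonal i) f).symm
    _ = ∑' j, ∑' k, f (j, k) := ENNReal.tsum_prod'
    _ = ∑' j, (w j : ℝ≥0∞) * l j := by
        simp only [f, ENNReal.tsum_mul_left, tsum_tsub_succ_add hl hlim]

end Sequences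

/-! ### Lorentz classes -/

section LorentzNorm

variable {𝕜 E F G : Type*} [NontriviallyNormedField 𝕜] [NormedAddCommGroup E] [NormedSpace 𝕜 E]
  [NormedAddCommGroup F] [NormedSpace 𝕜 F] [NormedAddCommGroup G] [NormedSpace 𝕜 G]
  {w : ℕ → ℝ≥0} {p : ℝ}

/-- The weighted `ℓ^p` norm of the approximation numbers of a bounded operator. It agrees with
`schattenNorm α p` on compact operators when `w` is the sequence of increments of `α`. -/
def lorentzNorm (w : ℕ → ℝ≥0) (p : ℝ) (a : E →L[𝕜] F) : ℝ≥0∞ :=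
  weightedNorm w p (approxNumber a)

theorem lorentzNorm_smul (hp : 0 < p) (c : 𝕜) (a : E →L[𝕜] F) :
    lorentzNorm w p (c • a) = ‖c‖₊ * lorentzNorm w p a := by
  rw [lorentzNorm, funext (approxNumber_smul c a), weightedNorm_const_mul hp, lorentzNorm]

theorem lorentzNorm_comp_le_right (hp : 0 < p) (a : F →L[𝕜] G) (b : E →L[𝕜] F) :
    lorentzNorm w p (a ∘L b) ≤ ‖b‖₊ * lorentzNorm w p a := by
  rw [lorentzNorm, lorentzNorm, ← weightedNorm_const_mul hp]
  exact weightedNorm_mono hp.le fun n =>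
    (approxNumber_comp_le_right a b n).trans_eq (mul_comm _ _)

theorem lorentzNorm_comp_le_left (hp : 0 < p) (a : E →L[𝕜] F) (b : F →L[𝕜] G) :
    lorentzNorm w p (b ∘L a) ≤ ‖b‖₊ * lorentzNorm w p a := by
  rw [lorentzNorm, lorentzNorm, ← weightedNorm_const_mul hp]
  exact weightedNorm_mono hp.le (approxNumber_comp_le_left a b)

theorem coe_rpow_mul_nnnorm_le_lorentzNorm (hp : 0 < p) (a : E →L[𝕜] F) :
    ((w 0 ^ (1 / p) * ‖a‖₊ : ℝ≥0) : ℝ≥0∞) ≤ lorentzNorm w p a := by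
  rw [← approxNumber_zero]
  exact coe_rpow_mul_le_weightedNorm hp

theorem lowerSemicontinuous_lorentzNorm (hp : 0 ≤ p) :
    LowerSemicontinuous (lorentzNorm w p : (E →L[𝕜] F) → ℝ≥0∞) :=
  (lowerSemicontinuous_weightedNorm w hp).comp (continuous_pi continuous_approxNumber)

end LorentzNorm

section LorentzClass

variable {𝕜 E F G : Type*} [RCLike 𝕜] [NormedAddCommGroup E] [InnerProductSpace 𝕜 E]
  [CompleteSpace E] [NormedAddCommGroup F] [InnerProductSpace 𝕜 F] [CompleteSpace F]
  [NormedAddCommGroup G] [InnerProductSpace 𝕜 G] [CompleteSpace G]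
  {w : ℕ → ℝ≥0} {p : ℝ}

theorem lorentzNorm_adjoint (w : ℕ → ℝ≥0) (p : ℝ) (a : E →L[𝕜] F) :
    lorentzNorm w p a.adjoint = lorentzNorm w p a := by
  rw [lorentzNorm, funext (approxNumber_adjoint a), lorentzNorm]

theorem lorentzNorm_add_le (hw : Antitone w) (hp : 1 ≤ p) {a b : E →L[𝕜] F}
    (hab : IsCompactOperator (a + b)) :
    lorentzNorm w p (a + b) ≤ lorentzNorm w p a + lorentzNorm w p b := by
  have hKyFan : ∀ k, ∑ j ∈ Finset.range k, approxNumber (a + b) j ≤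
      ∑ j ∈ Finset.range k, (approxNumber a + approxNumber b) j := fun k => by
    simpa only [Pi.add_apply, Finset.sum_add_distrib] using
      sum_approxNumber_add_le (tendsto_approxNumber_of_isCompactOperator hab) k
  calc lorentzNorm w p (a + b) ≤ weightedNorm w p (approxNumber a + approxNumber b) :=
        weightedNorm_le_of_sum_range_le hw (approxNumber_antitone _) hKyFan hp
    _ ≤ lorentzNorm w p a + lorentzNorm w p b := weightedNorm_add_le w _ _ hp

/-- The Lorentz class: the compact operators of finite Lorentz norm. As a submodule it depends on
`hw` and `hp`, which make it closed under addition. -/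
def lorentzClass (hw : Antitone w) (hp : 1 ≤ p) : Submodule 𝕜 (E →L[𝕜] F) where
  carrier := {a | IsCompactOperator a ∧ lorentzNorm w p a < ∞}
  add_mem' ha hb := ⟨ha.1.add hb.1,
    (lorentzNorm_add_le hw hp (ha.1.add hb.1)).trans_lt (ENNReal.add_lt_top.mpr ⟨ha.2, hb.2⟩)⟩
  zero_mem' := ⟨isCompactOperator_zero, by
    rw [← zero_smul 𝕜 (0 : E →L[𝕜] F), lorentzNorm_smul (zero_lt_one.trans_le hp)]
    simp⟩
  smul_mem' c a ha := ⟨ha.1.smul c, by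
    rw [lorentzNorm_smul (zero_lt_one.trans_le hp)]
    exact ENNReal.mul_lt_top ENNReal.coe_lt_top ha.2⟩

theorem adjoint_mem_lorentzClass {hw : Antitone w} {hp : 1 ≤ p} {a : E →L[𝕜] F}
    (ha : a ∈ lorentzClass hw hp) : a.adjoint ∈ lorentzClass hw hp :=
  ⟨isCompactOperator_adjoint ha.1, (lorentzNorm_adjoint w p a).trans_lt ha.2⟩

theorem comp_mem_lorentzClass_of_left_mem {hw : Antitone w} {hp : 1 ≤ p} {a : F →L[𝕜] G}
    (ha : a ∈ lorentzClass hw hp) (b : E →L[𝕜] F) : a ∘L b ∈ lorentzClass hw hp :=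
  ⟨ha.1.comp_clm b, (lorentzNorm_comp_le_right (zero_lt_one.trans_le hp) a b).trans_lt
    (ENNReal.mul_lt_top ENNReal.coe_lt_top ha.2)⟩

theorem comp_mem_lorentzClass_of_right_mem {hw : Antitone w} {hp : 1 ≤ p} {a : E →L[𝕜] F}
    (ha : a ∈ lorentzClass hw hp) (b : F →L[𝕜] G) : b ∘L a ∈ lorentzClass hw hp :=
  ⟨ha.1.clm_comp b, (lorentzNorm_comp_le_left (zero_lt_one.trans_le hp) a b).trans_lt
    (ENNReal.mul_lt_top ENNReal.coe_lt_top ha.2)⟩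

theorem isCompactOperator_of_mem_closure_lorentzClass {hw : Antitone w} {hp : 1 ≤ p}
    {a : E →L[𝕜] F}
    (ha : a ∈ closure ((lorentzClass hw hp : Submodule 𝕜 (E →L[𝕜] F)) : Set (E →L[𝕜] F))) :
    IsCompactOperator a := by
  have hclosed : IsClosed {b : E →L[𝕜] F | IsCompactOperator b} :=
    isClosed_setOfPred_isCompactOperator
  exact closure_minimal (fun _ hb => hb.1) hclosed ha

end LorentzClass

section Completeness

theorem isBanachWith_of_cauchy {E : Type*} [AddCommGroup E] [Module ℂ E] {N : E → ℝ}
    (hnonneg : ∀ x, 0 ≤ N x) (hsmul : ∀ (c : ℂ) x, N (c • x) = ‖c‖ * N x)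
    (hadd : ∀ x y, N (x + y) ≤ N x + N y) (hzero : ∀ x, N x = 0 → x = 0)
    (hcomplete : ∀ u : ℕ → E, (∀ ε > 0, ∃ M, ∀ m ≥ M, ∀ n ≥ M, N (u m - u n) < ε) →
      ∃ x, ∀ ε > 0, ∃ M, ∀ n ≥ M, N (u n - x) < ε) : IsBanachWith N := by
  have hN0 : N 0 = 0 := by simpa using hsmul 0 0
  let _ : Norm E := ⟨N⟩
  have core : NormedSpace.Core ℂ E :=
    { norm_nonneg := hnonneg
      norm_smul := hsmul
      norm_triangle := hadd
      norm_eq_zero_iff := fun x => ⟨hzero x, fun hx => (congrArg N hx).trans hN0⟩ }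
  refine ⟨core, ?_⟩
  let _ : NormedAddCommGroup E := NormedAddCommGroup.ofCore core
  have hdist : ∀ x y : E, dist x y = N (x - y) := dist_eq_norm
  refine Metric.complete_of_cauchySeq_tendsto fun u hu => ?_
  obtain ⟨x, hx⟩ := hcomplete u (by simpa only [Metric.cauchySeq_iff, hdist] using hu)
  exact ⟨x, Metric.tendsto_atTop.mpr (by simpa only [hdist] using hx)⟩

variable {E : Type*} [NormedAddCommGroup E] [CompleteSpace E] {N : E → ℝ≥0∞} {c : ℝ≥0}

theorem exists_tendsto_of_lowerSemicontinuous (hN : LowerSemicontinuous N) (hc : 0 < c)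
    (hbound : ∀ x, ((c * ‖x‖₊ : ℝ≥0) : ℝ≥0∞) ≤ N x) {u : ℕ → E}
    (hu : ∀ ε : ℝ≥0, 0 < ε → ∃ M, ∀ m ≥ M, ∀ n ≥ M, N (u m - u n) ≤ ε) :
    ∃ x, Tendsto u atTop (𝓝 x) ∧ ∀ ε : ℝ≥0, 0 < ε → ∃ M, ∀ n ≥ M, N (u n - x) ≤ ε := by
  have hcauchy : CauchySeq u := Metric.cauchySeq_iff.mpr fun ε hε => by
    lift ε to ℝ≥0 using hε.le
    obtain ⟨M, hM⟩ := hu (c * (ε / 2)) (mul_pos hc (half_pos hε))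
    refine ⟨M, fun m hm n hn => ?_⟩
    have hle : c * ‖u m - u n‖₊ ≤ c * (ε / 2) :=
      ENNReal.coe_le_coe.mp ((hbound _).trans (hM m hm n hn))
    rw [dist_eq_norm]
    exact ((mul_le_mul_iff_of_pos_left hc).mp hle).trans_lt (half_lt_self hε)
  obtain ⟨x, hx⟩ := cauchySeq_tendsto_of_complete hcauchy
  refine ⟨x, hx, fun ε hε => (hu ε hε).imp fun M hM n hn => ?_⟩
  have hclosed : IsClosed {y | N y ≤ ε} := hN.isClosed_preimage ε
  exact hclosed.mem_of_tendsto (tendsto_const_nhds.sub hx)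
    ((eventually_ge_atTop M).mono fun m hm => hM n hn m hm)

theorem isBanachWith_toReal_of_lowerSemicontinuous [NormedSpace ℂ E] (hN : LowerSemicontinuous N)
    (hc : 0 < c) (hbound : ∀ x, ((c * ‖x‖₊ : ℝ≥0) : ℝ≥0∞) ≤ N x)
    (hsmul : ∀ (k : ℂ) x, N (k • x) = ‖k‖₊ * N x) {V : Submodule ℂ E}
    (hadd : ∀ x ∈ V, ∀ y ∈ V, N (x + y) ≤ N x + N y) (hfin : ∀ x ∈ V, N x < ∞)
    (hmem : ∀ x ∈ closure (V : Set E), N x < ∞ → x ∈ V) :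
    IsBanachWith fun x : V => (N x).toReal := by
  refine isBanachWith_of_cauchy (fun _ => ENNReal.toReal_nonneg) (fun k x => ?_) (fun x y => ?_)
    (fun x hx => ?_) fun u hu => ?_
  · rw [Submodule.coe_smul, hsmul, ENNReal.toReal_mul, ENNReal.coe_toReal, coe_nnnorm]
  · rw [← ENNReal.toReal_add (hfin x x.2).ne (hfin y y.2).ne]
    exact ENNReal.toReal_mono (ENNReal.add_lt_top.mpr ⟨hfin x x.2, hfin y y.2⟩).ne
      (hadd x x.2 y y.2)
  · have hzero : N x = 0 := ((ENNReal.toReal_eq_zero_iff _).mp hx).resolve_right (hfin x x.2).ne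
    simpa [hzero, hc.ne'] using hbound x
  · obtain ⟨x, hux, hx⟩ := exists_tendsto_of_lowerSemicontinuous hN hc hbound
      (u := fun n => (u n : E)) fun ε hε => (hu ε hε).imp fun M hM m hm n hn =>
        (ENNReal.toReal_le_toReal (hfin _ (u m - u n).2).ne ENNReal.coe_ne_top).mp
          (hM m hm n hn).le
    have hxV : x ∈ V := by
      obtain ⟨M, hM⟩ := hx 1 one_pos
      have hcl : u M - x ∈ closure (V : Set E) :=
        mem_closure_of_tendsto (tendsto_const_nhds.sub hux)
          (Eventually.of_forall fun n => (u M - u n).2)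
      simpa using V.sub_mem (u M).2 (hmem _ hcl ((hM M le_rfl).trans_lt ENNReal.coe_lt_top))
    refine ⟨⟨x, hxV⟩, fun ε hε => ?_⟩
    lift ε to ℝ≥0 using hε.le
    refine (hx (ε / 2) (half_pos hε)).imp fun M hM n hn => ?_
    exact (ENNReal.toReal_mono ENNReal.coe_ne_top (hM n hn)).trans_lt
      (NNReal.half_lt_self (NNReal.coe_pos.mp hε).ne')

theorem isBanachWith_lorentzNorm {F G : Type*} [NormedAddCommGroup F] [InnerProductSpace ℂ F]
    [CompleteSpace F] [NormedAddCommGroup G] [InnerProductSpace ℂ G] [CompleteSpace G]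
    {w : ℕ → ℝ≥0} (hw : Antitone w) (hw0 : 0 < w 0) {p : ℝ} (hp : 1 ≤ p) :
    IsBanachWith fun a : (lorentzClass hw hp : Submodule ℂ (F →L[ℂ] G)) =>
      (lorentzNorm w p (a : F →L[ℂ] G)).toReal :=
  have hp0 : 0 < p := zero_lt_one.trans_le hp
  isBanachWith_toReal_of_lowerSemicontinuous (lowerSemicontinuous_lorentzNorm hp0.le)
    (NNReal.rpow_pos hw0) (coe_rpow_mul_nnnorm_le_lorentzNorm (𝕜 := ℂ) hp0)
    (lorentzNorm_smul (𝕜 := ℂ) (E := F) (F := G) hp0)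
    (fun _ ha _ hb => lorentzNorm_add_le hw hp (ha.1.add hb.1)) (fun _ ha => ha.2)
    fun _ ha hlt => ⟨isCompactOperator_of_mem_closure_lorentzClass ha, hlt⟩

end Completeness

section Schatten

variable {α : ℕ → ℝ≥0}

/-- The increments `α (j + 1) - α j` of a weight sequence. The subtraction is truncated, so this is
meaningful only for increasing `α`. -/
def increment (α : ℕ → ℝ≥0) (j : ℕ) : ℝ≥0 := α (j + 1) - α j

theorem increment_antitone
    (hconc : ∀ i : ℕ, 1 ≤ i → (α (i + 1) + α (i - 1)) / 2 ≤ α i) : Antitone (increment α) := by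
  refine antitone_nat_of_succ_le fun i => ?_
  have hi : α (i + 2) + α i ≤ α (i + 1) * 2 := by
    simpa using (div_le_iff₀ two_pos).mp (hconc (i + 1) i.succ_pos)
  rw [increment, increment, tsub_le_iff_right]
  calc α (i + 2) ≤ α (i + 1) + α (i + 1) - α i := by
        rw [← mul_two]
        exact le_tsub_of_add_le_right hi
    _ ≤ α (i + 1) - α i + α (i + 1) := add_tsub_le_tsub_add

theorem schattenNorm_eq_lorentzNorm {H : Type*} [NormedAddCommGroup H] [InnerProductSpace ℂ H]
    [CompleteSpace H] (hmono : Monotone α) (h0 : α 0 = 0) {p : ℝ} (hp : 0 < p) {a : H →L[ℂ] H}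
    (ha : IsCompactOperator a) : schattenNorm α p a = lorentzNorm (increment α) p a := by
  have hanti : Antitone fun i => approxNumber a i ^ p := fun i j hij =>
    NNReal.rpow_le_rpow (approxNumber_antitone a hij) hp.le
  have hlim : Tendsto (fun i => approxNumber a i ^ p) atTop (𝓝 0) := by
    simpa [NNReal.zero_rpow hp.ne'] using
      (tendsto_approxNumber_of_isCompactOperator ha).nnrpow tendsto_const_nhds (.inr hp)
  have htelescope : ∀ i, ∑ j ∈ Finset.range (i + 1), increment α j = α (i + 1) := fun i =>
    (Finset.sum_range_tsub hmono (i + 1)).trans (by rw [h0, tsub_zero])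
  have hgap : ∀ i, ENNReal.ofReal
      (eigenvalueSeq (CFC.abs a ^ p) i - eigenvalueSeq (CFC.abs a ^ p) (i + 1)) =
        ((approxNumber a i ^ p - approxNumber a (i + 1) ^ p : ℝ≥0) : ℝ≥0∞) := fun i => by
    rw [eigenvalueSeq_abs_rpow ha hp, eigenvalueSeq_abs_rpow ha hp, ← NNReal.coe_rpow,
      ← NNReal.coe_rpow, ← NNReal.coe_sub (hanti i.le_succ), ENNReal.ofReal_coe_nnreal]
  have hparts := tsum_tsub_succ_mul_sum_range (increment α) hanti hlim
  simp only [← ENNReal.ofNNReal_finsetSum, htelescope, ENNReal.coe_rpow_of_nonneg _ hp.le]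
    at hparts
  simp only [schattenNorm, choquetTrace, hgap, lorentzNorm, weightedNorm, hparts]

end Schatten

end Choquet

end

open Choquet in
theorem mainTheorem4_general {H : Type*} [NormedAddCommGroup H] [InnerProductSpace ℂ H]
    [CompleteSpace H] (p : ℝ) (hp : 1 ≤ p)
    (α : ℕ → ℝ≥0) (hmono : Monotone α) (h0 : α 0 = 0) (h1 : 0 < α 1)
    (hconc : ∀ i : ℕ, 1 ≤ i → (α (i + 1) + α (i - 1)) / 2 ≤ α i) :
    ∃ V : Submodule ℂ (H →L[ℂ] H),
      (V : Set (H →L[ℂ] H)) = schattenClass H α p ∧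
      IsBanachWith (fun a : V => (schattenNorm α p (a : H →L[ℂ] H)).toReal) ∧
      (∀ a ∈ V, star a ∈ V) ∧
      (∀ a ∈ V, ∀ b : H →L[ℂ] H, a * b ∈ V ∧ b * a ∈ V) := by
  have hw : Antitone (increment α) := increment_antitone hconc
  have hw0 : 0 < increment α 0 := by simpa [increment, h0] using h1
  have hnorm : ∀ {a : H →L[ℂ] H}, IsCompactOperator a →
      schattenNorm α p a = lorentzNorm (increment α) p a :=
    schattenNorm_eq_lorentzNorm hmono h0 (zero_lt_one.trans_le hp)
  refine ⟨lorentzClass hw hp, ?_, ?_, fun _ ha => adjoint_mem_lorentzClass ha, fun _ ha b =>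
    ⟨comp_mem_lorentzClass_of_left_mem ha b, comp_mem_lorentzClass_of_right_mem ha b⟩⟩
  · ext a
    exact and_congr_right fun ha => by rw [hnorm ha]
  · have hfun : (fun a : (lorentzClass hw hp : Submodule ℂ (H →L[ℂ] H)) =>
        (schattenNorm α p (a : H →L[ℂ] H)).toReal) =
          fun a => (lorentzNorm (increment α) p a.1).toReal :=
      funext fun a => by rw [hnorm a.2.1]
    exact hfun ▸ isBanachWith_lorentzNorm hw hw0 hp

theorem mainTheorem4 {H : Type*} [NormedAddCommGroup H] [InnerProductSpace ℂ H] [CompleteSpace H]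
    [TopologicalSpace.SeparableSpace H] (hH : ¬ FiniteDimensional ℂ H)
    (p : ℝ) (hp : 1 ≤ p)
    (α : ℕ → ℝ≥0) (hmono : Monotone α) (h0 : α 0 = 0) (h1 : 0 < α 1)
    (hconc : ∀ i : ℕ, 1 ≤ i → (α (i + 1) + α (i - 1)) / 2 ≤ α i) :
    ∃ V : Submodule ℂ (H →L[ℂ] H),
      (V : Set (H →L[ℂ] H)) = Choquet.schattenClass H α p ∧
      Choquet.IsBanachWith (fun a : V => (Choquet.schattenNorm α p (a : H →L[ℂ] H)).toReal) ∧
      (∀ a ∈ V, star a ∈ V) ∧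
      (∀ a ∈ V, ∀ b : H →L[ℂ] H, a * b ∈ V ∧ b * a ∈ V) :=
  mainTheorem4_general p hp α hmono h0 h1 hconc
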